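/- Let $H=(V,E)$ be a hypergraph, i.e. $V$ is a finite set and $E$ is a set of subsets of $V$ (the edges), each with more than one element. A path in $H$ is a sequence $v_1,f_1,v_2,f_2,\dots,f_m,v_{m+1}$ ($m\ge 0$) with $f_i\in E$ and $v_i,v_{i+1}\in f_i$, in which the edges are distinct and the vertices are distinct except that $v_1=v_{m+1}$ is allowed; it is a cycle if $v_1=v_{m+1}$ and $m>1$. $H$ is a hypertree if any two vertices are joined by a path and $H$ has no cycles; in a hypertree there is then exactly one path between two given distinct vertices. A coloring $\chi:V\to\{1,2,3,\dots\}$ is proper if no edge of $H$ is monochromatic, that is, $\chi$ is not constant on any edge. The chromatic symmetric function of $H$ is the formal power series over $\mathbb{Q}$ in the commuting variables $x_1,x_2,\dots$ $$X_H=\sum_{\chi}\prod_{v\in V}x_{\chi(v)},$$ where the sum is over all proper colorings $\chi$ of $H$. For $S\subseteq\{1,\dots,n-1\}$ the fundamental quasisymmetric function of degree $n$ is $$F_S=\sum x_{i_1}x_{i_2}\cdots x_{i_n},$$ where the sum is over all sequences of positive integers $i_1\le i_2\le\dots\le i_n$ with $i_j<i_{j+1}$ for every $j\in S$. **Theorem.**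 Let $H=(V,E)$ be a hypertree with $|V|=n$ such that $|e|$ is a prime number for every $e\in E$. Fix an ordering $E=\{e_1,\dots,e_k\}$ of the edges such that $|(e_1\cup\dots\cup e_i)\cap e_{i+1}|=1$ for all $1\le i<k$, and for every $i$ fix a cyclic permutation $c_i:e_i\to e_i$ (a permutation of $e_i$ that is a single cycle through all elements of $e_i$). Then $$X_H=\sum_{\pi\in\mathfrak S_V}F_{\mathrm{Des}_H(\pi)},$$ where $\mathfrak S_V$ is the set of bijections $\pi:V\to\{1,\dots,n\}$ and $\mathrm{Des}_H(\pi)\subseteq\{1,\dots,n-1\}$ is the set of $H$-descents of $\pi$, defined as follows. For $1\le i<n$ let $$\pi^{-1}(i)=v_1,\,e_{j_1},\,v_2,\,e_{j_2},\,\dots,\,e_{j_l},\,v_{l+1}=\pi^{-1}(i+1)$$ be the unique path in $H$ from $\pi^{-1}(i)$ to $\pi^{-1}(i+1)$, and let $r$ be the position with $j_r=\min(j_1,\dots,j_l)$. Then $i$ is an $H$-descent of $\pi$ if and only if $\pi(c_{j_r}(v_r))>\pi(c_{j_r}(v_{r+1}))$. -/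

import Mathlib

open scoped BigOperators

namespace Hypergraph

section Hypertrees

variable {V : Type*}

/-- `v 0, f 0, v 1, f 1, …, f (m-1), v m` is a path in `H`: consecutive vertices lie in the edge
between them, the edges are distinct, and the vertices are distinct except that the first may
equal the last. The one-term sequence `v 0` (`m = 0`) counts as a path. -/
structure IsPath (H : Hypergraph V) {m : ℕ} (v : Fin (m + 1) → V) (f : Fin m → Set V) : Prop where
  edge_mem : ∀ i : Fin m, f i ∈ H.edgeSet
  left_mem : ∀ i : Fin m, v i.castSucc ∈ f i
  right_mem : ∀ i : Fin m, v i.succ ∈ f i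
  edge_injective : Function.Injective f
  vertex_distinct : ∀ i j : Fin (m + 1), i < j → v i = v j → i = 0 ∧ j = Fin.last m

/-- A path with more than one edge that returns to its first vertex. -/
def IsCycle (H : Hypergraph V) {m : ℕ} (v : Fin (m + 1) → V) (f : Fin m → Set V) : Prop :=
  H.IsPath v f ∧ 1 < m ∧ v 0 = v (Fin.last m)

/-- Any two vertices are joined by a path. -/
def IsConnected (H : Hypergraph V) : Prop :=
  ∀ x ∈ H.vertexSet, ∀ y ∈ H.vertexSet,
    ∃ (m : ℕ) (v : Fin (m + 1) → V) (f : Fin m → Set V),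
      H.IsPath v f ∧ v 0 = x ∧ v (Fin.last m) = y

/-- A hypertree: all edges have more than one element, and the hypergraph is connected and has
no cycles. -/
structure IsHypertree (H : Hypergraph V) : Prop where
  one_lt_ncard : ∀ e ∈ H.edgeSet, 1 < e.ncard
  connected : H.IsConnected
  acyclic : ∀ (m : ℕ) (v : Fin (m + 1) → V) (f : Fin m → Set V), ¬ H.IsCycle v f

/-- The edge ordering `e 0, e 1, …, e (k-1)` is such that every edge other than the first one meets
the union of the earlier edges in exactly one vertex. -/
def IsNiceOrder (H : Hypergraph V) {k : ℕ} (e : Fin k ≃ H.edgeSet) : Prop :=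
  ∀ i : Fin k, 0 < i.val →
    ((⋃ j : Fin k, ⋃ _ : j < i, (e j : Set V)) ∩ (e i : Set V)).ncard = 1

/-- A coloring (by positive integers) of the vertices is proper if no edge is monochromatic. -/
def IsProper (H : Hypergraph V) (χ : V → ℕ+) : Prop :=
  ∀ e ∈ H.edgeSet, ¬ ∃ i : ℕ+, ∀ v ∈ e, χ v = i

end Hypertrees

end Hypergraph

namespace Chromatic

/-- The formal sum of a family of power series in `x₁, x₂, …`, taken coefficient by coefficient.
It is meant for families in which every coefficient is nonzero for only finitely many members. -/
noncomputable def formalSum {ι : Type*} (f : ι → MvPowerSeries ℕ+ ℚ) : MvPowerSeries ℕ+ ℚ :=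
  fun d => ∑ᶠ a : ι, MvPowerSeries.coeff d (f a)

theorem coeff_prod_X {ι : Type*} [Fintype ι] (χ : ι → ℕ+) (d : ℕ+ →₀ ℕ)
    [Decidable (d = ∑ v, Finsupp.single (χ v) 1)] :
    MvPowerSeries.coeff d (∏ v, (MvPowerSeries.X (χ v) : MvPowerSeries ℕ+ ℚ)) =
      if d = ∑ v, Finsupp.single (χ v) 1 then 1 else 0 := by
  classical
  have h : ∀ s : Finset ι, (∏ v ∈ s, (MvPowerSeries.X (χ v) : MvPowerSeries ℕ+ ℚ)) =
      MvPowerSeries.monomial (∑ v ∈ s, Finsupp.single (χ v) 1) 1 := by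
    intro s
    induction s using Finset.induction_on with
    | empty => simp
    | insert a s ha ih =>
      rw [Finset.prod_insert ha, Finset.sum_insert ha, ih, MvPowerSeries.X,
        MvPowerSeries.monomial_mul_monomial, one_mul]
  rw [h, MvPowerSeries.coeff_monomial]
  split_ifs <;> rfl

/-- Any family of monomials `∏ v, x_{χ(v)}`, indexed by functions `χ` on a finite type, is locally
finite, so that its formal sum is a genuine sum. -/
theorem finite_support_coeff {ι : Type*} [Fintype ι] (P : (ι → ℕ+) → Prop) (d : ℕ+ →₀ ℕ) :
    (Function.support fun χ : {χ : ι → ℕ+ // P χ} =>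
      MvPowerSeries.coeff d (∏ v, (MvPowerSeries.X (χ.1 v) : MvPowerSeries ℕ+ ℚ))).Finite := by
  classical
  have hfin : {χ : ι → ℕ+ | ∀ v, χ v ∈ d.support}.Finite := by
    have := Set.Finite.pi (fun _ : ι => d.support.finite_toSet)
    refine this.subset ?_
    intro χ hχ v _
    exact hχ v
  refine (hfin.preimage Subtype.val_injective.injOn).subset ?_
  intro χ hχ v
  rw [Function.mem_support, coeff_prod_X] at hχ
  have hd : d = ∑ w, Finsupp.single (χ.1 w) 1 := by
    by_contra hne
    exact hχ (if_neg hne)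
  rw [Finsupp.mem_support_iff, hd, Finsupp.finsetSum_apply]
  have : Finsupp.single (χ.1 v) 1 (χ.1 v) ≤ ∑ w, Finsupp.single (χ.1 w) 1 (χ.1 v) :=
    Finset.single_le_sum (f := fun w => Finsupp.single (χ.1 w) 1 (χ.1 v))
      (fun _ _ => Nat.zero_le _) (Finset.mem_univ v)
  rw [Finsupp.single_eq_same] at this
  omega

/-- The chromatic symmetric function `X_H = ∑_χ ∏_v x_{χ(v)}`, summed over the proper colorings of
`H`, for a hypergraph `H` whose vertex set is all of the finite type `V`. -/
noncomputable def chromaticSymmetric {V : Type*} [Fintype V] (H : Hypergraph V) :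
    MvPowerSeries ℕ+ ℚ :=
  formalSum fun χ : {χ : V → ℕ+ // H.IsProper χ} => ∏ v, MvPowerSeries.X (χ.1 v)

/-- The sequences `a₁ ≤ a₂ ≤ … ≤ aₙ` with `aᵢ < aᵢ₊₁` for `i ∈ S`; here `aᵢ` is
`a ⟨i - 1, _⟩`, since `Fin n` starts at `0`. -/
def IsAdmissible (n : ℕ) (S : Set ℕ) (a : Fin n → ℕ+) : Prop :=
  Monotone a ∧
    ∀ (j : ℕ) (h : j + 1 < n), j + 1 ∈ S → a ⟨j, Nat.lt_of_succ_lt h⟩ < a ⟨j + 1, h⟩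

/-- The fundamental quasisymmetric function `F_S` of degree `n`, for `S ⊆ {1, …, n-1}`. -/
noncomputable def fundamental (n : ℕ) (S : Set ℕ) : MvPowerSeries ℕ+ ℚ :=
  formalSum fun a : {a : Fin n → ℕ+ // IsAdmissible n S a} => ∏ j, MvPowerSeries.X (a.1 j)

/-- There is a path `x = v 0, e (j 0), v 1, …, e (j (m-1)), v m = y` such that, for the least index
`j r` occurring in it, the label of `c (v r)` exceeds that of `c (v (r+1))`, where `c` is the
permutation of the edge `e (j r)`. In a hypertree the path between distinct `x`, `y` is unique. -/
def DescendsAlongPath {V : Type*} (H : Hypergraph V) {k : ℕ} (e : Fin k ≃ H.edgeSet)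
    (c : (i : Fin k) → Equiv.Perm (e i : Set V)) {n : ℕ} (π : V ≃ Fin n) (x y : V) : Prop :=
  ∃ (m : ℕ) (v : Fin (m + 1) → V) (j : Fin m → Fin k)
    (hp : H.IsPath v fun s => (e (j s) : Set V)),
      v 0 = x ∧ v (Fin.last m) = y ∧
        ∃ r : Fin m, (∀ s : Fin m, j r ≤ j s) ∧
          π (c (j r) ⟨v r.succ, hp.right_mem r⟩ : V) <
            π (c (j r) ⟨v r.castSucc, hp.left_mem r⟩ : V)

/-- The set of `H`-descents of `π`, a subset of `{1, …, n-1}`: it contains `i = j + 1` when the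
vertices labeled `i` and `i + 1` (that is, `j` and `j + 1` in `Fin n`, which starts at `0`) form
a descent. -/
def hDescents {V : Type*} (H : Hypergraph V) {k : ℕ} (e : Fin k ≃ H.edgeSet)
    (c : (i : Fin k) → Equiv.Perm (e i : Set V)) {n : ℕ} (π : V ≃ Fin n) : Set ℕ :=
  {i | ∃ (j : ℕ) (h : j + 1 < n), i = j + 1 ∧
    DescendsAlongPath H e c π (π.symm ⟨j, Nat.lt_of_succ_lt h⟩) (π.symm ⟨j + 1, h⟩)}

end Chromatic

/-!
For an edge `e i` and a vertex `x` of the hypertree `H`, let `P i x` be the *gate* of `x` on `e i`,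
the vertex of `e i` at which every path from `x` to `e i` arrives (`Hypergraph.IsHypertree.gate`).
The path from `x` to `y` uses `e i` if and only if `P i x ≠ P i y`, and then it passes from `P i x`
to `P i y` there. Hence `x, y` is a descent of `π` if and only if the sequence of labels
`i ↦ π (c i (P i x))` is lexicographically larger for `x` than for `y`
(`Chromatic.descendsAlongPath_iff`), and a coloring `χ` contributes to `F_{Des π}` by way of `π` if
and only if `π` lists the vertices in increasing order of the keys
`(χ x, i ↦ π (c i (P i x)))` (`Chromatic.isAdmissible_hDescents_iff`). Call `π` *self-sorted* then.

It remains to see that a proper coloring has exactly one self-sorted labeling and that an improper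
one has none. On an edge, the keys of two vertices compare by the color and then by the labels of
their `c i`-successors. If `e i` were monochromatic, `c i` would thus preserve the order of the
labels on `e i` and have a fixed point (`Chromatic.IsSelfSorted.not_monochromatic`). If no edge is
monochromatic, iterating the rule shows that labels on `e i` compare as the color words
`χ a, χ (c i a), χ (c i (c i a)), …` do, which are pairwise distinct because `c i` is a cycle of
prime length (`Chromatic.colorWord_injective`). So the labels in the keys may be replaced by color
words, which depend on `χ` only, and the one self-sorted labeling is obtained by sorting with the
resulting keys (`Chromatic.existsUnique_isSelfSorted`).
-/

/-! ### Gates in hypertrees -/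

namespace Hypergraph

variable {V : Type*}

/-- The graph joining two distinct vertices of `H` when they share an edge of `H` other than `g`. -/
def linkGraph (H : Hypergraph V) (g : Set V) : SimpleGraph V where
  Adj u w := u ≠ w ∧ ∃ f ∈ H.edgeSet, f ≠ g ∧ u ∈ f ∧ w ∈ f
  symm := ⟨fun _ _ ⟨hne, f, hf, hfg, hu, hw⟩ => ⟨hne.symm, f, hf, hfg, hw, hu⟩⟩
  loopless := ⟨fun _ h => h.1 rfl⟩

theorem linkGraph_reachable_of_mem {H : Hypergraph V} {f g : Set V} (hf : f ∈ H.edgeSet)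
    (hfg : f ≠ g) {u w : V} (hu : u ∈ f) (hw : w ∈ f) : (H.linkGraph g).Reachable u w := by
  by_cases h : u = w
  · exact h ▸ SimpleGraph.Reachable.refl u
  · exact SimpleGraph.Adj.reachable ⟨h, f, hf, hfg, hu, hw⟩

theorem IsPath.reachable_segment {H : Hypergraph V} {m : ℕ} {v : Fin (m + 1) → V}
    {f : Fin m → Set V} (hp : H.IsPath v f) {g : Set V} {a b : Fin (m + 1)} (hab : a ≤ b)
    (hg : ∀ t : Fin m, a ≤ t.castSucc → t.succ ≤ b → f t ≠ g) :
    (H.linkGraph g).Reachable (v a) (v b) := by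
  induction b using Fin.induction with
  | zero =>
    obtain rfl : a = 0 := le_antisymm hab (Fin.zero_le _)
    exact SimpleGraph.Reachable.refl _
  | succ t ih =>
    rcases hab.eq_or_lt with rfl | hlt
    · exact SimpleGraph.Reachable.refl _
    · have hle : a ≤ t.castSucc := Fin.le_castSucc_iff.2 hlt
      refine (ih hle fun s hs hst => hg s hs (hst.trans ?_)).trans ?_
      · exact (Fin.castSucc_lt_succ (i := t)).le
      · exact linkGraph_reachable_of_mem (hp.edge_mem t) (hg t hle le_rfl)
          (hp.left_mem t) (hp.right_mem t)

/-- A walk in the link graph shortens to a path of the hypergraph: along a geodesic, an edge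
used twice would give a shortcut. -/
theorem exists_isPath_of_reachable {H : Hypergraph V} {g : Set V} {a b : V}
    (h : (H.linkGraph g).Reachable a b) :
    ∃ (m : ℕ) (v : Fin (m + 1) → V) (f : Fin m → Set V), H.IsPath v f ∧ Function.Injective v ∧
      (∀ t, f t ≠ g) ∧ v 0 = a ∧ v (Fin.last m) = b := by
  obtain ⟨p, hp⟩ := h.exists_walk_length_eq_dist
  have hdist : ∀ t ≤ p.length, (H.linkGraph g).dist a (p.getVert t) = t := by
    intro t ht
    have h1 := SimpleGraph.dist_le (p.take t)
    have h2 := SimpleGraph.dist_le (p.drop t)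
    have h3 := (p.take t).reachable.dist_triangle_left b
    rw [SimpleGraph.Walk.take_length] at h1
    rw [SimpleGraph.Walk.drop_length] at h2
    omega
  have hadj : ∀ t : Fin p.length, ∃ f ∈ H.edgeSet, f ≠ g ∧ p.getVert t ∈ f ∧
      p.getVert (t + 1) ∈ f := fun t => (p.adj_getVert_succ t.2).2
  choose f hfE hfg hl hr using hadj
  have hinj : Function.Injective fun t : Fin (p.length + 1) => p.getVert t := by
    intro s t hst
    have hs := hdist s (Nat.lt_succ_iff.1 s.2)
    have ht := hdist t (Nat.lt_succ_iff.1 t.2)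
    have hst' : p.getVert s = p.getVert t := hst
    rw [hst'] at hs
    exact Fin.ext (hs.symm.trans ht)
  have hlt : ∀ s t : Fin p.length, s < t → f s ≠ f t := by
    intro s t hst heq
    have hs := hdist s s.2.le
    have ht := hdist (t + 1) t.2
    have hst' : (s : ℕ) < t := hst
    have hadj : (H.linkGraph g).Adj (p.getVert s) (p.getVert (t + 1)) := by
      refine ⟨fun h => ?_, f s, hfE s, hfg s, hl s, heq ▸ hr t⟩
      rw [h] at hs
      omega
    have h1 := SimpleGraph.dist_eq_one_iff_adj.2 hadj
    have h2 := hadj.reachable.dist_triangle_right a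
    omega
  refine ⟨p.length, fun t => p.getVert t, f, ⟨hfE, hl, ?_, ?_, ?_⟩, hinj, hfg, ?_, ?_⟩
  · intro t
    simpa using hr t
  · intro s t hst
    by_contra hne
    rcases lt_or_gt_of_ne hne with h | h
    · exact hlt s t h hst
    · exact hlt t s h hst.symm
  · intro i j hij heq
    exact absurd (hinj heq) hij.ne
  · simp
  · simp

/-- Two vertices of an edge `g` joined by a path avoiding `g` coincide, as `g` would otherwise
close that path to a cycle. -/
theorem IsHypertree.eq_of_reachable {H : Hypergraph V} (hH : H.IsHypertree) {g : Set V}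
    (hg : g ∈ H.edgeSet) {a b : V} (ha : a ∈ g) (hb : b ∈ g)
    (h : (H.linkGraph g).Reachable a b) : a = b := by
  by_contra hab
  obtain ⟨m, v, f, hp, hv, hfg, h0, hlast⟩ := exists_isPath_of_reachable h
  have hm : 0 < m := by
    rcases Nat.eq_zero_or_pos m with rfl | hm
    · exact absurd (h0.symm.trans hlast) hab
    · exact hm
  refine hH.acyclic (m + 1) (Fin.snoc v a) (Fin.snoc f g)
    ⟨⟨?_, ?_, ?_, ?_, ?_⟩, by omega, ?_⟩
  · intro i
    induction i using Fin.lastCases with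
    | last => simpa using hg
    | cast i => simpa using hp.edge_mem i
  · intro i
    induction i using Fin.lastCases with
    | last => simpa [hlast] using hb
    | cast i => simpa using hp.left_mem i
  · intro i
    induction i using Fin.lastCases with
    | last => simpa using ha
    | cast i =>
      rw [Fin.succ_castSucc, Fin.snoc_castSucc, Fin.snoc_castSucc]
      exact hp.right_mem i
  · exact Fin.snoc_injective_iff.2 ⟨hp.edge_injective, fun ⟨t, ht⟩ => hfg t ht⟩
  · intro i j hij heq
    induction i using Fin.lastCases with
    | last => exact absurd hij (Fin.le_last j).not_gt
    | cast i =>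
      induction j using Fin.lastCases with
      | last =>
        rw [Fin.snoc_castSucc, Fin.snoc_last, ← h0] at heq
        rw [hv heq]
        exact ⟨rfl, rfl⟩
      | cast j =>
        rw [Fin.snoc_castSucc, Fin.snoc_castSucc] at heq
        exact absurd (congrArg Fin.castSucc (hv heq)) hij.ne
  · rw [Fin.snoc_last, ← Fin.castSucc_zero, Fin.snoc_castSucc, h0]

theorem IsHypertree.exists_gate {H : Hypergraph V} (hH : H.IsHypertree)
    (hV : H.vertexSet = Set.univ) {g : Set V} (hg : g ∈ H.edgeSet) (x : V) :
    ∃ a : g, (H.linkGraph g).Reachable x a := by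
  have hpos : 0 < g.ncard := zero_lt_one.trans (hH.one_lt_ncard g hg)
  obtain ⟨a, ha⟩ := Set.nonempty_of_ncard_ne_zero hpos.ne'
  obtain ⟨m, v, f, hp, h0, hlast⟩ :=
    hH.connected x (hV ▸ Set.mem_univ x) a (hV ▸ Set.mem_univ a)
  by_cases hex : ∃ r, f r = g
  · obtain ⟨r, hr⟩ := hex
    refine ⟨⟨v r.castSucc, hr ▸ hp.left_mem r⟩, ?_⟩
    rw [← h0]
    refine hp.reachable_segment (Fin.zero_le _) fun t _ ht hft => ?_
    have : t = r := hp.edge_injective (hft.trans hr.symm)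
    subst this
    exact (Fin.castSucc_lt_succ (i := t)).not_ge ht
  · push Not at hex
    refine ⟨⟨a, ha⟩, ?_⟩
    have := hp.reachable_segment (g := g) (Fin.zero_le (Fin.last m)) fun t _ _ => hex t
    rwa [h0, hlast] at this

/-- The gate of a vertex `x` on an edge `g` of a hypertree: the vertex of `g` that is joined to
`x` without using `g`, hence the one at which every path from `x` to `g` arrives. -/
noncomputable def IsHypertree.gate {H : Hypergraph V} (hH : H.IsHypertree)
    (hV : H.vertexSet = Set.univ) {g : Set V} (hg : g ∈ H.edgeSet) (x : V) : g :=
  (hH.exists_gate hV hg x).choose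

theorem IsHypertree.gate_eq {H : Hypergraph V} (hH : H.IsHypertree)
    (hV : H.vertexSet = Set.univ) {g : Set V} (hg : g ∈ H.edgeSet) {x : V} {a : g}
    (h : (H.linkGraph g).Reachable x a) : hH.gate hV hg x = a :=
  Subtype.ext <| hH.eq_of_reachable hg (Subtype.property _) a.2 <|
    (hH.exists_gate hV hg x).choose_spec.symm.trans h

theorem IsHypertree.gate_congr {H : Hypergraph V} (hH : H.IsHypertree)
    (hV : H.vertexSet = Set.univ) {g : Set V} (hg : g ∈ H.edgeSet) {x y : V}
    (h : (H.linkGraph g).Reachable x y) : hH.gate hV hg x = hH.gate hV hg y :=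
  hH.gate_eq hV hg (h.trans (hH.exists_gate hV hg y).choose_spec)

theorem IsHypertree.gate_start {H : Hypergraph V} (hH : H.IsHypertree)
    (hV : H.vertexSet = Set.univ) {m : ℕ} {v : Fin (m + 1) → V} {f : Fin m → Set V}
    (hp : H.IsPath v f) (r : Fin m) :
    hH.gate hV (hp.edge_mem r) (v 0) = ⟨v r.castSucc, hp.left_mem r⟩ := by
  refine hH.gate_eq hV _ (hp.reachable_segment (Fin.zero_le _) fun t _ ht hft => ?_)
  obtain rfl := hp.edge_injective hft
  exact (Fin.castSucc_lt_succ (i := t)).not_ge ht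

theorem IsHypertree.gate_end {H : Hypergraph V} (hH : H.IsHypertree)
    (hV : H.vertexSet = Set.univ) {m : ℕ} {v : Fin (m + 1) → V} {f : Fin m → Set V}
    (hp : H.IsPath v f) (r : Fin m) :
    hH.gate hV (hp.edge_mem r) (v (Fin.last m)) = ⟨v r.succ, hp.right_mem r⟩ := by
  refine hH.gate_eq hV _
    (hp.reachable_segment (Fin.le_last _) fun t ht _ hft => ?_).symm
  obtain rfl := hp.edge_injective hft
  exact (Fin.castSucc_lt_succ (i := t)).not_ge ht

theorem IsHypertree.gate_ends_eq {H : Hypergraph V} (hH : H.IsHypertree)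
    (hV : H.vertexSet = Set.univ) {m : ℕ} {v : Fin (m + 1) → V} {f : Fin m → Set V}
    (hp : H.IsPath v f) {g : Set V} (hg : g ∈ H.edgeSet) (hfg : ∀ t, f t ≠ g) :
    hH.gate hV hg (v 0) = hH.gate hV hg (v (Fin.last m)) :=
  hH.gate_congr hV hg (hp.reachable_segment (Fin.zero_le _) fun t _ _ => hfg t)

theorem IsPath.castSucc_ne_succ {H : Hypergraph V} {m : ℕ} {v : Fin (m + 1) → V}
    {f : Fin m → Set V} (hp : H.IsPath v f) (hne : v 0 ≠ v (Fin.last m)) (r : Fin m) :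
    v r.castSucc ≠ v r.succ := by
  intro h
  obtain ⟨h0, h1⟩ := hp.vertex_distinct _ _ (Fin.castSucc_lt_succ (i := r)) h
  exact hne (by rw [← h0, ← h1, h])

end Hypergraph

namespace Chromatic

variable {V : Type*} {k : ℕ} {s : Fin k → Set V}

/-! ### Sorting keys -/

/-- The abstract properties of the gates `P i : V → s i` of the edges `s i` of a hypertree: a
vertex of an edge is its own gate there, all vertices of one edge have the same gate on any other
edge, and distinct vertices are told apart by some gate. -/
structure IsGateSystem (P : ∀ i, V → s i) : Prop where
  gate_self : ∀ i (a : s i), P i a = a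
  gate_eq_of_ne : ∀ i i', i' ≠ i → ∀ a b : s i, P i' a = P i' b
  exists_gate_ne : ∀ x y, x ≠ y → ∃ i, P i x ≠ P i y

/-- The sorting key of a vertex `v`: its color, and then, in lexicographic order, the `φ`-values
of the successors `c i (P i v)` of its gates. -/
def gateKey {α : Type*} (P : ∀ i, V → s i) (c : ∀ i, Equiv.Perm (s i)) (χ : V → ℕ+)
    (φ : ∀ i, s i → α) (v : V) : Lex (ℕ+ × Lex (Fin k → α)) :=
  toLex (χ v, toLex fun i => φ i (c i (P i v)))

/-- The colors read along the permutation `c` from `a` on, ordered lexicographically. -/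
def colorWord {t : Set V} (c : Equiv.Perm t) (χ : V → ℕ+) (a : t) : Lex (ℕ → ℕ+) :=
  toLex fun n => χ ((c ^ n) a : t)

section Key

variable {α : Type*} {P : ∀ i, V → s i} {c : ∀ i, Equiv.Perm (s i)}
  {χ : V → ℕ+} {φ : ∀ i, s i → α}

theorem gateKey_injective (hP : IsGateSystem P) (hφ : ∀ i, Function.Injective (φ i)) :
    Function.Injective (gateKey P c χ φ) := by
  intro x y hxy
  by_contra hne
  obtain ⟨i, hi⟩ := hP.exists_gate_ne x y hne
  have h : toLex (fun i => φ i (c i (P i x))) = toLex (fun i => φ i (c i (P i y))) :=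
    congrArg (fun z => (ofLex z).2) hxy
  exact hi ((c i).injective (hφ i (congrFun (toLex.injective h) i)))

variable [LinearOrder α]

theorem gateKey_lt_iff {x y : V} : gateKey P c χ φ x < gateKey P c χ φ y ↔
    χ x < χ y ∨ χ x = χ y ∧ ∃ i, (∀ i' < i, φ i' (c i' (P i' x)) = φ i' (c i' (P i' y))) ∧
      φ i (c i (P i x)) < φ i (c i (P i y)) :=
  Prod.Lex.lt_iff

/-- On an edge only one coordinate of the key matters besides the color. -/
theorem gateKey_lt_iff_of_mem (hP : IsGateSystem P) {i : Fin k} {a b : s i} :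
    gateKey P c χ φ a < gateKey P c χ φ b ↔
      χ a < χ b ∨ χ a = χ b ∧ φ i (c i a) < φ i (c i b) := by
  rw [gateKey_lt_iff]
  refine or_congr_right (and_congr_right fun _ => ⟨?_, fun h => ⟨i, fun i' hi' => ?_, ?_⟩⟩)
  · rintro ⟨i', -, h⟩
    by_cases hi : i' = i
    · subst hi
      rwa [hP.gate_self, hP.gate_self] at h
    · rw [hP.gate_eq_of_ne i i' hi a b] at h
      exact absurd h (lt_irrefl _)
  · rw [hP.gate_eq_of_ne i i' hi'.ne a b]
  · rwa [hP.gate_self, hP.gate_self]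

theorem gateKey_lt_of_gateKey_lt {β : Type*} [LinearOrder β] {ψ : ∀ i, s i → β}
    (hφ : ∀ i, Function.Injective (φ i)) (h : ∀ i a b, φ i a < φ i b → ψ i a < ψ i b) {x y : V}
    (hxy : gateKey P c χ φ x < gateKey P c χ φ y) : gateKey P c χ ψ x < gateKey P c χ ψ y := by
  rw [gateKey_lt_iff] at hxy ⊢
  refine hxy.imp_right (And.imp_right ?_)
  rintro ⟨i, heq, hlt⟩
  exact ⟨i, fun i' hi' => congrArg (ψ i') (hφ i' (heq i' hi')), h i _ _ hlt⟩

end Key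

/-! ### Color words -/

section Word

variable {t : Set V} {c : Equiv.Perm t} {χ : V → ℕ+}

theorem colorWord_lt_iff {a b : t} : colorWord c χ a < colorWord c χ b ↔
    ∃ n : ℕ, (∀ m < n, χ ((c ^ m) a : t) = χ ((c ^ m) b : t)) ∧
      χ ((c ^ n) a : t) < χ ((c ^ n) b : t) :=
  Iff.rfl

/-- This is the rule by which keys compare vertices of one edge; see `gateKey_lt_iff_of_mem`. -/
theorem colorWord_lt_iff_shift {a b : t} : colorWord c χ a < colorWord c χ b ↔
    χ a < χ b ∨ χ a = χ b ∧ colorWord c χ (c a) < colorWord c χ (c b) := by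
  simp only [colorWord_lt_iff, ← Equiv.Perm.mul_apply, ← pow_succ]
  constructor
  · rintro ⟨n, heq, hlt⟩
    cases n with
    | zero => exact Or.inl hlt
    | succ n =>
      exact Or.inr ⟨heq 0 n.succ_pos, n, fun m hm => heq (m + 1) (Nat.succ_lt_succ hm), hlt⟩
  · rintro (h | ⟨h, n, heq, hlt⟩)
    · exact ⟨0, fun m hm => absurd hm m.not_lt_zero, h⟩
    · refine ⟨n + 1, fun m hm => ?_, hlt⟩
      cases m with
      | zero => exact h
      | succ m => exact heq m (Nat.lt_of_succ_lt_succ hm)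

/-- Words along a cycle of prime length are distinct unless all colors agree: if the words of `a`
and `c ^ m a` agree, the coloring is invariant under `c ^ m`, which is transitive as soon as the
length does not divide `m`. -/
theorem colorWord_injective [Finite t] (hc : c.IsCycleOn Set.univ) (hp : (Nat.card t).Prime)
    (hχ : ¬ ∃ i : ℕ+, ∀ v ∈ t, χ v = i) : Function.Injective (colorWord c χ) := by
  intro a b hab
  by_contra hne
  have := Fintype.ofFinite t
  rw [Nat.card_eq_fintype_card] at hp
  have hc' : c.IsCycleOn ((Finset.univ : Finset t) : Set t) := by rwa [Finset.coe_univ]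
  obtain ⟨m, -, hm⟩ := hc'.exists_pow_eq (Finset.mem_univ a) (Finset.mem_univ b)
  have hdvd : ¬ Fintype.card t ∣ m := fun h =>
    hne (((hc'.pow_apply_eq (Finset.mem_univ a)).2 h).symm.trans hm)
  have hcop : Nat.Coprime m (Fintype.card t) := ((hp.coprime_iff_not_dvd).2 hdvd).symm
  have hword : ∀ n, χ ((c ^ n) a : t) = χ ((c ^ (n + m)) a : t) := by
    intro n
    rw [pow_add, Equiv.Perm.mul_apply, hm]
    exact congrFun (toLex.injective hab) n
  have hinv : ∀ q, χ ((c ^ (m * q)) a : t) = χ a := by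
    intro q
    induction q with
    | zero => simp
    | succ q ih => rw [Nat.mul_succ, ← hword, ih]
  refine hχ ⟨χ a, fun v hv => ?_⟩
  obtain ⟨n, -, hn⟩ := hc'.exists_pow_eq (Finset.mem_univ a) (Finset.mem_univ ⟨v, hv⟩)
  obtain ⟨q, -, hq⟩ := Nat.exists_mul_mod_eq_of_coprime n hcop hp.ne_zero
  have hq' : (c ^ (m * q)) a = (c ^ n) a :=
    (hc'.pow_apply_eq_pow_apply (Finset.mem_univ a)).2 hq
  rw [← hinv q, hq', hn]

end Word

/-! ### Labelings sorted by their own keys -/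

section Sorting

variable {n : ℕ} {P : ∀ i, V → s i} {c : ∀ i, Equiv.Perm (s i)} {χ : V → ℕ+}

/-- The labeling `π` lists the vertices in increasing order of the keys computed from `π`. -/
def IsSelfSorted (P : ∀ i, V → s i) (c : ∀ i, Equiv.Perm (s i)) (χ : V → ℕ+) (π : V ≃ Fin n) :
    Prop :=
  ∀ x y, π x < π y → gateKey P c χ (fun _ a => π a) x < gateKey P c χ (fun _ a => π a) y

theorem IsSelfSorted.lt_of_gateKey_lt {π : V ≃ Fin n} (h : IsSelfSorted P c χ π) {x y : V}
    (hxy : gateKey P c χ (fun _ a => π a) x < gateKey P c χ (fun _ a => π a) y) : π x < π y := by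
  by_contra hle
  rcases (not_lt.1 hle).eq_or_lt with heq | hlt
  · rw [π.injective heq] at hxy
    exact lt_irrefl _ hxy
  · exact lt_asymm hxy (h y x hlt)

/-- If an edge were monochromatic, the permutation of it would preserve the order of the labels,
hence fix the vertex with the largest label. -/
theorem IsSelfSorted.not_monochromatic (hP : IsGateSystem P) {π : V ≃ Fin n}
    (h : IsSelfSorted P c χ π) {i : Fin k} (hc : (c i).IsCycleOn Set.univ)
    (hs : (s i).Nontrivial) : ¬ ∃ q : ℕ+, ∀ v ∈ s i, χ v = q := by
  rintro ⟨q, hq⟩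
  have hmono : ∀ a b : s i, π a < π b → π (c i a) < π (c i b) := by
    intro a b hab
    rcases (gateKey_lt_iff_of_mem hP).1 (h a b hab) with h' | h'
    · rw [hq a a.2, hq b b.2] at h'
      exact absurd h' (lt_irrefl _)
    · exact h'.2
  have : Finite V := Finite.of_equiv _ π.symm
  have : Nontrivial (s i) := hs.coe_sort
  obtain ⟨a, ha⟩ := Finite.exists_max fun a : s i => π a
  refine hc.apply_ne Set.nontrivial_univ (Set.mem_univ ((c i).symm a)) ?_
  rw [Equiv.apply_symm_apply]
  by_contra hne
  have hlt : π ((c i).symm a : s i) < π a :=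
    lt_of_le_of_ne (ha _) fun heq => hne (Subtype.ext (π.injective heq)).symm
  have := hmono _ _ hlt
  rw [Equiv.apply_symm_apply] at this
  exact (ha _).not_gt this

/-- A self-sorted labeling orders each edge by its color words. -/
theorem IsSelfSorted.lt_of_colorWord_lt (hP : IsGateSystem P) {π : V ≃ Fin n}
    (h : IsSelfSorted P c χ π) {i : Fin k} {a b : s i}
    (hab : colorWord (c i) χ a < colorWord (c i) χ b) : π a < π b := by
  obtain ⟨m, heq, hlt⟩ := colorWord_lt_iff.1 hab
  clear hab
  induction m generalizing a b with
  | zero => exact h.lt_of_gateKey_lt ((gateKey_lt_iff_of_mem hP).2 (Or.inl hlt))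
  | succ m ih =>
    refine h.lt_of_gateKey_lt
      ((gateKey_lt_iff_of_mem hP).2 (Or.inr ⟨heq 0 m.succ_pos, ih (fun l hl => ?_) ?_⟩))
    · simpa only [← Equiv.Perm.mul_apply, ← pow_succ] using heq (l + 1) (Nat.succ_lt_succ hl)
    · simpa only [← Equiv.Perm.mul_apply, ← pow_succ] using hlt

/-- Sorting by the keys made of color words, which do not mention labels, gives the only
self-sorted labeling: on each edge, the labels compare as the color words do. -/
theorem existsUnique_isSelfSorted [Fintype V] (hn : Fintype.card V = n) (hP : IsGateSystem P)
    (hχ : ∀ i, Function.Injective (colorWord (c i) χ)) :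
    ∃! π : V ≃ Fin n, IsSelfSorted P c χ π := by
  let _ : LinearOrder V := LinearOrder.lift' (gateKey P c χ fun i => colorWord (c i) χ)
    (gateKey_injective hP hχ)
  have hlt : ∀ x y : V, x < y ↔ gateKey P c χ (fun i => colorWord (c i) χ) x <
      gateKey P c χ (fun i => colorWord (c i) χ) y := fun _ _ => Iff.rfl
  let ρ : V ≃o Fin n := (Fintype.orderIsoFinOfCardEq V hn).symm
  refine ⟨ρ.toEquiv, fun x y hxy => ?_, fun π hπ => ?_⟩
  · refine gateKey_lt_of_gateKey_lt hχ (fun i a b hab => ?_) ((hlt x y).1 (ρ.lt_iff_lt.1 hxy))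
    exact ρ.lt_iff_lt.2 ((hlt a b).2
      ((gateKey_lt_iff_of_mem hP).2 (colorWord_lt_iff_shift.1 hab)))
  · have hmono : StrictMono π := fun x y hxy =>
      hπ.lt_of_gateKey_lt (gateKey_lt_of_gateKey_lt (ψ := fun _ a => π a) hχ
        (fun i a b hab => hπ.lt_of_colorWord_lt hP hab) ((hlt x y).1 hxy))
    let π' : V ≃o Fin n := ⟨π, hmono.le_iff_le⟩
    exact congrArg RelIso.toEquiv (Subsingleton.elim π' ρ)

end Sorting

/-! ### Coefficients -/

section Series

/-- A coloring contributes its monomial to `F_{S π}` exactly when, listed along `π`, it is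
admissible for `S π`; if this happens for one `π` when `p χ` holds and for none otherwise, the sum
of the `F_{S π}` is the sum of the monomials of the colorings satisfying `p`. -/
theorem sum_fundamental_eq [Fintype V] [DecidableEq V] {n : ℕ} (S : (V ≃ Fin n) → Set ℕ)
    (p : (V → ℕ+) → Prop)
    (hp : ∀ χ, p χ → ∃! π : V ≃ Fin n, IsAdmissible n (S π) (χ ∘ π.symm))
    (hnp : ∀ χ (π : V ≃ Fin n), IsAdmissible n (S π) (χ ∘ π.symm) → p χ) :
    formalSum (fun χ : {χ : V → ℕ+ // p χ} => ∏ v, MvPowerSeries.X (χ.1 v)) =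
      ∑ π : V ≃ Fin n, fundamental n (S π) := by
  classical
  ext d
  set g : (V → ℕ+) → ℚ := fun χ =>
    MvPowerSeries.coeff d (∏ v, (MvPowerSeries.X (χ v) : MvPowerSeries ℕ+ ℚ)) with hg
  have hfin : (Function.support g).Finite := by
    refine ((finite_support_coeff (fun _ : V → ℕ+ => True) d).image Subtype.val).subset ?_
    exact fun χ hχ => ⟨⟨χ, trivial⟩, hχ, rfl⟩
  have hfund : ∀ π : V ≃ Fin n, MvPowerSeries.coeff d (fundamental n (S π)) =
      ∑ᶠ χ, if IsAdmissible n (S π) (χ ∘ π.symm) then g χ else 0 := by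
    intro π
    have h1 : MvPowerSeries.coeff d (fundamental n (S π)) =
        ∑ᶠ a : {a : Fin n → ℕ+ // IsAdmissible n (S π) a},
          MvPowerSeries.coeff d (∏ j, (MvPowerSeries.X (a.1 j) : MvPowerSeries ℕ+ ℚ)) := rfl
    rw [h1, finsum_subtype_eq_finsum_cond (f := fun a : Fin n → ℕ+ =>
        MvPowerSeries.coeff d (∏ j, (MvPowerSeries.X (a j) : MvPowerSeries ℕ+ ℚ))),
      ← finsum_comp_equiv (Equiv.arrowCongr π (Equiv.refl ℕ+))]
    refine finsum_congr fun χ => ?_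
    rw [finsum_eq_if]
    have h2 : (Equiv.arrowCongr π (Equiv.refl ℕ+)) χ = χ ∘ π.symm := rfl
    rw [h2, hg]
    simp only [Function.comp_apply]
    rw [Equiv.prod_comp π.symm fun v => (MvPowerSeries.X (χ v) : MvPowerSeries ℕ+ ℚ)]
  have hchrom : MvPowerSeries.coeff d
      (formalSum fun χ : {χ : V → ℕ+ // p χ} => ∏ v, MvPowerSeries.X (χ.1 v)) =
      ∑ᶠ χ, if p χ then g χ else 0 := by
    have h1 : MvPowerSeries.coeff d
        (formalSum fun χ : {χ : V → ℕ+ // p χ} => ∏ v, MvPowerSeries.X (χ.1 v)) =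
        ∑ᶠ χ : {χ : V → ℕ+ // p χ}, g χ := rfl
    rw [h1, finsum_subtype_eq_finsum_cond (f := g)]
    exact finsum_congr fun χ => finsum_eq_if
  rw [hchrom, map_sum, Finset.sum_congr rfl fun π _ => hfund π, ← finsum_sum_comm]
  · refine finsum_congr fun χ => ?_
    split_ifs with h
    · obtain ⟨π, hπ, huniq⟩ := hp χ h
      rw [Finset.sum_eq_single π (fun π' _ hne => if_neg fun h' => hne (huniq π' h'))
        (fun h' => absurd (Finset.mem_univ π) h'), if_pos hπ]
    · exact (Finset.sum_eq_zero fun π _ => if_neg fun h' => h (hnp χ π h')).symm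
  · intro π _
    refine hfin.subset fun χ hχ hχ0 => hχ ?_
    simp only [hχ0, ite_self]

end Series

/-! ### Descents in hypertrees -/

section Hypertree

variable {H : Hypergraph V} (e : Fin k ≃ H.edgeSet)

/-- Two distinct vertices have different gates on every edge of the path between them. -/
theorem _root_.Hypergraph.IsHypertree.isGateSystem (hH : H.IsHypertree)
    (hV : H.vertexSet = Set.univ) :
    IsGateSystem (s := fun i => (e i : Set V)) fun i => hH.gate hV (e i).2 where
  gate_self i a := hH.gate_eq hV _ (SimpleGraph.Reachable.refl _)
  gate_eq_of_ne i i' hi a b := hH.gate_congr hV _ <|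
    Hypergraph.linkGraph_reachable_of_mem (e i).2
      (fun h => hi (e.injective (Subtype.ext h)).symm) a.2 b.2
  exists_gate_ne x y hxy := by
    obtain ⟨m, v, f, hp, rfl, rfl⟩ :=
      hH.connected x (hV ▸ Set.mem_univ x) y (hV ▸ Set.mem_univ y)
    have hm : 0 < m := by
      rcases Nat.eq_zero_or_pos m with rfl | hm
      · exact absurd rfl hxy
      · exact hm
    have hne := hp.castSucc_ne_succ hxy ⟨0, hm⟩
    have hstart := hH.gate_start hV hp ⟨0, hm⟩
    have hend := hH.gate_end hV hp ⟨0, hm⟩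
    obtain ⟨i, hi⟩ := e.surjective ⟨_, hp.edge_mem ⟨0, hm⟩⟩
    have hi' : (e i : Set V) = f ⟨0, hm⟩ := congrArg Subtype.val hi
    refine ⟨i, fun h => hne ?_⟩
    have key : ∀ g (hg : g ∈ H.edgeSet), g = f ⟨0, hm⟩ →
        hH.gate hV hg (v 0) = hH.gate hV hg (v (Fin.last m)) →
        v (Fin.castSucc ⟨0, hm⟩) = v (Fin.succ ⟨0, hm⟩) := by
      rintro g hg rfl h
      rw [hstart, hend] at h
      exact congrArg Subtype.val h
    exact key _ _ hi' h

/-- The edge of least index on the path from `x` to `y` is the first edge on which `x` and `y`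
have different gates, and those gates are the neighbors of that edge on the path. -/
theorem descendsAlongPath_iff (hH : H.IsHypertree) (hV : H.vertexSet = Set.univ)
    (c : (i : Fin k) → Equiv.Perm (e i : Set V)) {n : ℕ} (π : V ≃ Fin n) {x y : V}
    (hxy : x ≠ y) :
    DescendsAlongPath H e c π x y ↔ ∃ i : Fin k,
      (∀ i' < i, hH.gate hV (e i').2 x = hH.gate hV (e i').2 y) ∧
        π (c i (hH.gate hV (e i).2 y) : V) < π (c i (hH.gate hV (e i).2 x) : V) := by
  constructor
  · rintro ⟨m, v, j, hp, rfl, rfl, r, hr, hlt⟩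
    refine ⟨j r, fun i' hi' => hH.gate_ends_eq hV hp _ fun t ht => ?_, ?_⟩
    · have : j t = i' := e.injective (Subtype.ext ht)
      exact (hr t).not_gt (this ▸ hi')
    · rwa [← hH.gate_start hV hp r, ← hH.gate_end hV hp r] at hlt
  · rintro ⟨i, hi, hlt⟩
    obtain ⟨m, v, f, hp, rfl, rfl⟩ :=
      hH.connected x (hV ▸ Set.mem_univ x) y (hV ▸ Set.mem_univ y)
    obtain ⟨j, rfl⟩ : ∃ j : Fin m → Fin k, f = fun t => (e (j t) : Set V) :=
      ⟨fun t => e.symm ⟨f t, hp.edge_mem t⟩, by simp⟩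
    have hex : ∃ r, j r = i := by
      by_contra hno
      push Not at hno
      rw [hH.gate_ends_eq hV hp (e i).2
        fun t ht => hno t (e.injective (Subtype.ext ht))] at hlt
      exact lt_irrefl _ hlt
    obtain ⟨r, rfl⟩ := hex
    refine ⟨m, v, j, hp, rfl, rfl, r, fun t => ?_, ?_⟩
    · by_contra hlt'
      have h := hi (j t) (not_le.1 hlt')
      rw [hH.gate_start hV hp t, hH.gate_end hV hp t] at h
      exact hp.castSucc_ne_succ hxy t (congrArg Subtype.val h)
    · rwa [← hH.gate_start hV hp r, ← hH.gate_end hV hp r]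

/-- Among vertices of equal color, a descent is a decrease of the key; so admissibility of the
colors listed by `π`, a condition on consecutive labels, says that `π` sorts by its keys. -/
theorem isAdmissible_hDescents_iff (hH : H.IsHypertree) (hV : H.vertexSet = Set.univ)
    (c : (i : Fin k) → Equiv.Perm (e i : Set V)) {n : ℕ} (π : V ≃ Fin n) (χ : V → ℕ+) :
    IsAdmissible n (hDescents H e c π) (χ ∘ π.symm) ↔
      IsSelfSorted (s := fun i => (e i : Set V)) (fun i => hH.gate hV (e i).2) c χ π := by
  set M : V → Lex (ℕ+ × Lex (Fin k → Fin n)) :=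
    gateKey (s := fun i => (e i : Set V)) (fun i => hH.gate hV (e i).2) c χ fun _ a => π a with hM
  have hinj : Function.Injective M := gateKey_injective (hH.isGateSystem e hV)
    fun i a b h => Subtype.ext (π.injective h)
  have hdesc : ∀ x y, x ≠ y → χ x = χ y → (DescendsAlongPath H e c π x y ↔ M y < M x) := by
    intro x y hxy hχ
    rw [descendsAlongPath_iff e hH hV c π hxy, hM, gateKey_lt_iff]
    simp only [hχ, lt_irrefl, false_or, true_and]
    refine exists_congr fun i => and_congr_left fun _ => forall₂_congr fun i' _ => ?_
    rw [π.injective.eq_iff, Subtype.val_inj, (c i').injective.eq_iff, eq_comm]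
  have hM_lt : ∀ {x y}, M x < M y → χ x ≤ χ y := fun h =>
    (gateKey_lt_iff.1 h).elim le_of_lt fun h => h.1.le
  constructor
  · rintro ⟨hmono, hstrict⟩
    have hstep : ∀ (j : ℕ) (h : j + 1 < n),
        M (π.symm ⟨j, Nat.lt_of_succ_lt h⟩) < M (π.symm ⟨j + 1, h⟩) := by
      intro j h
      have hne : π.symm ⟨j, Nat.lt_of_succ_lt h⟩ ≠ π.symm ⟨j + 1, h⟩ := by simp
      have hle : χ (π.symm ⟨j, Nat.lt_of_succ_lt h⟩) ≤ χ (π.symm ⟨j + 1, h⟩) :=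
        hmono (Fin.mk_le_mk.2 j.le_succ)
      rcases hle.lt_or_eq with hlt | heq
      · exact gateKey_lt_iff.2 (Or.inl hlt)
      · refine lt_of_le_of_ne (not_lt.1 fun hlt => ?_) (hinj.ne hne)
        exact (hstrict j h ⟨j, h, rfl, (hdesc _ _ hne heq).2 hlt⟩).ne heq
    have hsm : StrictMono (M ∘ π.symm) := by
      cases n with
      | zero => exact fun a => a.elim0
      | succ n => exact Fin.strictMono_iff_lt_succ.2 fun i => hstep i (Nat.succ_lt_succ i.2)
    intro x y hxy
    simpa using hsm hxy
  · intro h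
    have hlt : ∀ a b : Fin n, a < b → M (π.symm a) < M (π.symm b) := fun a b hab =>
      h _ _ (by simpa using hab)
    refine ⟨fun a b hab => ?_, ?_⟩
    · rcases hab.eq_or_lt with rfl | hab
      · exact le_rfl
      · exact hM_lt (hlt a b hab)
    · rintro j hj ⟨j', hj', heq, hd⟩
      obtain rfl : j = j' := Nat.succ_injective heq
      have hl := hlt _ _ (show (⟨j, Nat.lt_of_succ_lt hj⟩ : Fin n) < ⟨j + 1, hj⟩ from
        Fin.mk_lt_mk.2 j.lt_succ_self)
      refine lt_of_le_of_ne (hM_lt hl) fun hχ => ?_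
      exact lt_asymm hl ((hdesc _ _ (by simp) hχ).1 hd)

end Hypertree

end Chromatic

theorem theorem4p3 {V : Type*} [Fintype V] [DecidableEq V] (H : Hypergraph V)
    (hV : H.vertexSet = Set.univ) (hH : H.IsHypertree)
    (hprime : ∀ f ∈ H.edgeSet, Nat.Prime (f.ncard))
    {k : ℕ} (e : Fin k ≃ H.edgeSet) (he : H.IsNiceOrder e)
    (c : (i : Fin k) → Equiv.Perm (e i : Set V))
    (hc : ∀ i : Fin k, (c i).IsCycleOn Set.univ) :
    Chromatic.chromaticSymmetric H =
      ∑ π : V ≃ Fin (Fintype.card V),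
        Chromatic.fundamental (Fintype.card V) (Chromatic.hDescents H e c π) := by
  have hP := hH.isGateSystem e hV
  refine Chromatic.sum_fundamental_eq _ _ (fun χ hχ => ?_) fun χ π h f hf => ?_
  · simp only [Chromatic.isAdmissible_hDescents_iff e hH hV]
    exact Chromatic.existsUnique_isSelfSorted rfl hP fun i =>
      Chromatic.colorWord_injective (hc i) (hprime _ (e i).2) (hχ _ (e i).2)
  · rw [Chromatic.isAdmissible_hDescents_iff e hH hV] at h
    obtain ⟨i, hi⟩ := e.surjective ⟨f, hf⟩
    obtain rfl : (e i : Set V) = f := congrArg Subtype.val hi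
    exact h.not_monochromatic hP (hc i) (Set.one_lt_ncard_iff_nontrivial.1 (hprime _ hf).one_lt)
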